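/- A simple graph is called $n$-ordered if for every sequence $v_1,\dots,v_n$ of $n$ distinct vertices it contains a cycle that meets $v_1,\dots,v_n$ in this order. For integers $k\ge 2$ and $m\ge 5$ let $P_{k,m}$ be the bracelet graph with $m$ parts $V_1,\dots,V_m$ of sizes $|V_1|=|V_2|=k-1$, $|V_3|=k$ and $|V_i|=k+1$ for $4\le i\le m$; that is, the vertex set is the disjoint union of the $V_i$, and a vertex of $V_i$ is adjacent to a vertex of $V_j$ if and only if $i-j\equiv 1$ or $-1 \pmod m$. Theorem. Let $k\ge 2$. For every $m\ge 5$ the graph $P_{k,m}$ is $2k$-ordered and has minimum degree $2k-1$, and for every $m\ge 6$ it has maximum degree $2k+2$. The graphs $P_{k,m}$, $m\ge 5$, are pairwise non-isomorphic; in particular, $(P_{k,m})_{m\ge 6}$ is an infinite family of $2k$-ordered bracelet graphs with minimum degree $2k-1$ and maximum degree $2k+2$. -/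

import Mathlib

/-- A simple graph is `n`-ordered if for every sequence `l` of `n` distinct vertices there is a
cycle meeting these vertices in the given order. For a closed walk `c`, the list
`c.support.tail` runs once around the walk; when `c` is a cycle it lists every vertex of `c`
exactly once. The base point of the cycle is free, so the order is a cyclic one. -/
def IsKOrdered {V : Type*} (G : SimpleGraph V) (n : ℕ) : Prop :=
  ∀ l : List V, l.Nodup → l.length = n →
    ∃ (u : V) (c : G.Walk u u), c.IsCycle ∧ l.Sublist c.support.tail

/-- Two part indices `i`, `j` are cyclically adjacent: `i - j ≡ 1` or `-1` modulo `m`. -/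
def CyclicAdj (m : ℕ) (i j : Fin m) : Prop :=
  ((i : ℤ) - (j : ℤ) ≡ 1 [ZMOD (m : ℤ)]) ∨ ((i : ℤ) - (j : ℤ) ≡ -1 [ZMOD (m : ℤ)])

instance (m : ℕ) (i j : Fin m) : Decidable (CyclicAdj m i j) :=
  inferInstanceAs (Decidable (_ ∨ _))

theorem CyclicAdj.symm {m : ℕ} {i j : Fin m} (h : CyclicAdj m i j) : CyclicAdj m j i := by
  rcases h with h | h
  · right
    have := h.neg
    rwa [neg_sub] at this
  · left
    have := h.neg
    rwa [neg_sub, neg_neg] at this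

/-- `part : V → Fin m` exhibits `G` as a bracelet graph with `m` parts: there are at least three
parts, all of them are nonempty, and two vertices are adjacent exactly when their parts are
cyclically adjacent. -/
def IsBraceletPartition {V : Type*} (G : SimpleGraph V) {m : ℕ} (part : V → Fin m) : Prop :=
  3 ≤ m ∧ Function.Surjective part ∧ ∀ u v : V, G.Adj u v ↔ CyclicAdj m (part u) (part v)

/-- The bracelet graph whose parts, in cyclic order, have sizes `size 0, …, size (m - 1)`.
The clause `u ≠ v` only matters for the degenerate value `m = 1`. -/
def braceletGraph {m : ℕ} (size : Fin m → ℕ) : SimpleGraph (Σ i : Fin m, Fin (size i)) where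
  Adj u v := u ≠ v ∧ CyclicAdj m u.1 v.1
  symm := ⟨fun _ _ h => ⟨h.1.symm, h.2.symm⟩⟩
  loopless := ⟨fun _ h => h.1 rfl⟩

instance {m : ℕ} (size : Fin m → ℕ) : DecidableRel (braceletGraph size).Adj :=
  fun u v => inferInstanceAs (Decidable (u ≠ v ∧ CyclicAdj m u.1 v.1))

/-- The part sizes `k - 1, k - 1, k, k + 1, …, k + 1` (indices start at `0`). -/
def partSize (k m : ℕ) (i : Fin m) : ℕ :=
  if (i : ℕ) ≤ 1 then k - 1 else if (i : ℕ) = 2 then k else k + 1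

/-- The graph `P_{k,m}`: the bracelet graph with `m` parts, of sizes
`k - 1, k - 1, k, k + 1, …, k + 1`. -/
abbrev graphP (k m : ℕ) : SimpleGraph (Σ i : Fin m, Fin (partSize k m i)) :=
  braceletGraph (partSize k m)

/-! Only the parts of the vertices matter. If the part labels of a sequence lie in order on a closed
walk around the ring of parts, and the walk visits no part more often than the part has vertices,
then its visits can be filled with distinct vertices, which gives the required cycle
(`exists_nodup_lift`, `isKOrdered_of_routable`). It remains to route every label list of length `2k`
that respects the part sizes.

This goes by induction on `k`. Passing from `k` to `k + 1` enlarges every part by one, so one extra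
visit to each label is affordable. That pays for inserting two consecutive distinct labels into a
routed list, normally by one full turn around the ring in a suitable direction
(`Routable.insert_pair`). So one removes a consecutive pair of distinct labels, routes the rest, and
reinserts the pair.

The rest must fit the smaller capacities, so the pair has to contain every saturated label, one that
fills its enlarged part. With at most one saturated label this is easy. Two of them leave at most
two other entries, so either they are adjacent somewhere or they form two separated blocks; the size
count then forces the labels `0` and `1`, and `routable_blocks` gives the walk. Three are possible
only for `k = 1`, on labels `0`, `1`, `2` (`routable_of_three_full`). The induction can start at `k
= 1`, where parts `0` and `1` are empty, because labels may have capacity zero.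

Degrees are sums of two part sizes, and the number of vertices separates the graphs. -/

/-! ### Closed walks of labels with capacities -/

/-- A list `l` of labels is routable with capacities `s` if some closed `r`-walk, passing at most
`s i` times through each label `i`, meets the entries of `l` in this cyclic order. -/
def Routable {β : Type*} [DecidableEq β] (r : β → β → Prop) (s : β → ℕ) (l : List β) : Prop :=
  ∃ w : List β, Cycle.Chain r (w : Cycle β) ∧ l.Sublist w ∧ ∀ i, w.count i ≤ s i

theorem Cycle.Chain.list_reverse {β : Type*} {r : β → β → Prop} (hr : ∀ a b, r a b → r b a)
    {w : List β} (h : Cycle.Chain r (w : Cycle β)) : Cycle.Chain r (w.reverse : Cycle β) := by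
  cases w with
  | nil => exact h
  | cons a t =>
    rw [List.reverse_cons, ← Cycle.coe_cons_eq_coe_append, Cycle.chain_coe_cons]
    rw [Cycle.chain_coe_cons] at h
    have := List.isChain_reverse.mpr (h.imp fun a b hab => hr a b hab)
    simpa using this

namespace Routable

variable {β : Type*} [DecidableEq β] {r : β → β → Prop} {s s' : β → ℕ} {l l' : List β}

theorem mono (h : Routable r s l) (hs : ∀ i, s i ≤ s' i) : Routable r s' l := by
  obtain ⟨w, h1, h2, h3⟩ := h
  exact ⟨w, h1, h2, fun i => (h3 i).trans (hs i)⟩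

theorem of_isRotated (h : Routable r s l) (hl : l.IsRotated l') : Routable r s l' := by
  obtain ⟨w, h1, h2, h3⟩ := h
  obtain ⟨n, hn, rfl⟩ := List.isRotated_iff_mod.mp hl
  rw [List.rotate_eq_drop_append_take hn]
  rw [← List.take_append_drop n l] at h2
  obtain ⟨w₁, w₂, rfl, h4, h5⟩ := List.append_sublist_iff.mp h2
  refine ⟨w₂ ++ w₁, ?_, h5.append h4, fun i => ?_⟩
  · rwa [Cycle.coe_eq_coe.mpr (List.isRotated_append (l := w₂) (l' := w₁))]
  · have := h3 i
    simp only [List.count_append] at this ⊢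
    omega

theorem reverse (hr : ∀ a b, r a b → r b a) (h : Routable r s l) : Routable r s l.reverse := by
  obtain ⟨w, h1, h2, h3⟩ := h
  exact ⟨w.reverse, h1.list_reverse hr, h2.reverse, by simpa using h3⟩

/-- A closed walk through `v` can be spliced into another closed walk at `v`. -/
theorem splice {v : β} {q p t : List β} (h : Routable r s (v :: q))
    (ht : Cycle.Chain r ((v :: t : List β) : Cycle β)) (hp : p.Sublist (v :: t)) :
    Routable r (fun i => s i + (v :: t).count i) (p ++ v :: q) := by
  obtain ⟨w, h1, h2, h3⟩ := h
  obtain ⟨x, y, rfl, hx, hy⟩ := List.cons_sublist_iff.mp h2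
  obtain ⟨x₁, x₂, rfl⟩ := List.append_of_mem hx
  -- The walk is turned to start at the visit of `v` that the list uses. The prefix `x₁` moves to
  -- the end, so `y`, which carries `q`, still follows `v`.
  have hrot : List.IsRotated (x₁ ++ v :: x₂ ++ y) (v :: (x₂ ++ y ++ x₁)) := by
    have := List.isRotated_append (l := x₁) (l' := v :: x₂ ++ y)
    simpa using this
  have hc : Cycle.Chain r ((v :: (x₂ ++ y ++ x₁) : List β) : Cycle β) := by
    rwa [← Cycle.coe_eq_coe.mpr hrot]
  refine ⟨(v :: t) ++ (v :: (x₂ ++ y ++ x₁)), ?_, hp.append (List.Sublist.cons_cons v ?_), fun i => ?_⟩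
  · rw [List.cons_append, Cycle.chain_coe_cons]
    rw [Cycle.chain_coe_cons] at hc ht
    have := (List.isChain_split (R := r) (c := v) (l₁ := v :: t)
      (l₂ := (x₂ ++ y ++ x₁) ++ [v])).mpr ⟨by simpa using ht, hc⟩
    simpa using this
  · rw [List.append_assoc]
    exact (hy.trans (List.sublist_append_left y x₁)).trans (List.sublist_append_right x₂ _)
  · have h4 := h3 i
    rw [List.count_append, ← hrot.perm.count_eq i, Nat.add_comm]
    exact Nat.add_le_add_right h4 _

/-- Splicing in the closed walk `c, d` adds a visit to `c` for one further visit to each of `c` and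
`d`. -/
theorem detour (hr : ∀ a b, r a b → r b a) {c d : β} {q : List β} (h : Routable r s (c :: q))
    (hcd : r c d) : Routable r (fun i => s i + [c, d].count i) (c :: c :: q) := by
  refine h.splice (t := [d]) (p := [c]) ?_ (by simp)
  simpa using ⟨hcd, hr _ _ hcd⟩

end Routable

/-! ### From label walks to cycles in the graph -/

/-- A closed walk of labels meeting the labels of `l` lifts to a list of distinct elements
containing `l`, if no label is used more often than it is available. -/
theorem exists_nodup_lift {V β : Type*} [Fintype V] [DecidableEq V] [DecidableEq β] (f : V → β)
    {l' w : List β} (h : l'.Sublist w) :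
    ∀ (l : List V) (S : Finset V), l.map f = l' → l.Nodup → (∀ x ∈ l, x ∉ S) →
      (∀ i, w.count i + (S.filter (f · = i)).card ≤ (Finset.univ.filter (f · = i)).card) →
      ∃ c : List V, c.map f = w ∧ c.Nodup ∧ (∀ x ∈ c, x ∉ S) ∧ l.Sublist c := by
  induction h with
  | slnil =>
    intro l S hl _ _ _
    exact ⟨[], by simp, by simp, by simp, by simpa using hl⟩
  | @cons l' w i hsub ih =>
    intro l S hl hnd hS hcount
    -- An unmatched visit to `i` needs a vertex that is neither used (in `S`) nor reserved for later
    -- (in `l`). The reserved ones with label `i` are at most `w.count i`, so the capacity leaves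
    -- one free.
    have hex : ∃ x, f x = i ∧ x ∉ S ∧ x ∉ l := by
      by_contra! hcon
      have h1 : (Finset.univ.filter (f · = i)) ⊆
          S.filter (f · = i) ∪ (l.filter (f · = i)).toFinset := by
        intro x hx
        simp only [Finset.mem_filter, Finset.mem_univ, true_and, Finset.mem_union,
          List.mem_toFinset, List.mem_filter, decide_eq_true_eq] at hx ⊢
        by_cases hxS : x ∈ S
        · exact Or.inl ⟨hxS, hx⟩
        · exact Or.inr ⟨hcon x hx hxS, hx⟩
      have h2 := (Finset.card_le_card h1).trans (Finset.card_union_le _ _)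
      have h3 : (l.filter (f · = i)).toFinset.card ≤ w.count i := by
        refine (List.toFinset_card_le _).trans (le_trans (le_of_eq ?_) (hsub.count_le i))
        rw [← hl, List.count, List.countP_map, List.countP_eq_length_filter]
        congr 1
      have h4 := hcount i
      rw [List.count_cons_self] at h4
      omega
    obtain ⟨x, hx, hxS, hxl⟩ := hex
    obtain ⟨c, hc1, hc2, hc3, hc4⟩ := ih l (insert x S) hl hnd
      (fun y hy => by
        have : y ≠ x := fun h => hxl (h ▸ hy)
        simp [this, hS y hy])
      (fun j => by
        have h4 := hcount j
        rw [Finset.filter_insert]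
        split_ifs with hj
        · rw [Finset.card_insert_of_notMem (by simp [hxS])]
          rw [← hx, hj, List.count_cons_self] at h4
          omega
        · rw [List.count_cons_of_ne (by rw [← hx]; exact hj)] at h4
          exact h4)
    refine ⟨x :: c, by simp [hc1, hx], ?_, ?_, hc4.cons x⟩
    · refine List.nodup_cons.mpr ⟨fun h => hc3 x h (Finset.mem_insert_self x S), hc2⟩
    · intro y hy
      rcases List.mem_cons.mp hy with rfl | hy
      · exact hxS
      · exact fun h => hc3 y hy (Finset.mem_insert_of_mem h)
  | @cons_cons l' w i hsub ih =>
    intro l S hl hnd hS hcount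
    cases l with
    | nil => simp at hl
    | cons x l =>
      simp only [List.map_cons, List.cons.injEq] at hl
      obtain ⟨hx, hl⟩ := hl
      have hxS := hS x (by simp)
      obtain ⟨c, hc1, hc2, hc3, hc4⟩ := ih l (insert x S) hl (List.nodup_cons.mp hnd).2
        (fun y hy => by
          have : y ≠ x := fun h => (List.nodup_cons.mp hnd).1 (h ▸ hy)
          simp [this, hS y (by simp [hy])])
        (fun j => by
          have h4 := hcount j
          rw [Finset.filter_insert]
          split_ifs with hj
          · rw [Finset.card_insert_of_notMem (by simp [hxS])]
            rw [← hx, hj, List.count_cons_self] at h4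
            omega
          · rw [List.count_cons_of_ne (by rw [← hx]; exact hj)] at h4
            exact h4)
      refine ⟨x :: c, by simp [hc1, hx], ?_, ?_, hc4.cons_cons x⟩
      · refine List.nodup_cons.mpr ⟨fun h => hc3 x h (Finset.mem_insert_self x S), hc2⟩
      · intro y hy
        rcases List.mem_cons.mp hy with rfl | hy
        · exact hxS
        · exact fun h => hc3 y hy (Finset.mem_insert_of_mem h)

theorem SimpleGraph.Walk.IsPath.isCycle_cons {V : Type*} {G : SimpleGraph V} {u v : V}
    {p : G.Walk u v} (hp : p.IsPath) (h : G.Adj v u) (hlen : 2 ≤ p.length) :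
    (SimpleGraph.Walk.cons h p).IsCycle := by
  rw [SimpleGraph.Walk.isCycle_iff_isPath_tail_and_le_length]
  refine ⟨?_, by simp only [SimpleGraph.Walk.length_cons]; omega⟩
  rw [SimpleGraph.Walk.isPath_def, SimpleGraph.Walk.support_tail_of_not_nil _ (by simp)]
  simpa using hp.support_nodup

theorem SimpleGraph.exists_isCycle_of_chain {V : Type*} {G : SimpleGraph V} {c : List V}
    (hc : Cycle.Chain G.Adj (c : Cycle V)) (hnd : c.Nodup) (hlen : 3 ≤ c.length) :
    ∃ (u : V) (p : G.Walk u u), p.IsCycle ∧ p.support.tail = c := by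
  have hne : c ≠ [] := by rintro rfl; simp at hlen
  have hch := (Cycle.chain_ne_nil G.Adj hne).mp hc
  obtain ⟨u, v, p, hp, hadj⟩ : ∃ (u v : V) (p : G.Walk u v), p.support = c ∧ G.Adj v u := by
    refine ⟨_, _, SimpleGraph.Walk.ofSupport c hne hch.tail,
      SimpleGraph.Walk.support_ofSupport hne hch.tail, ?_⟩
    cases c with
    | nil => exact absurd rfl hne
    | cons x t => exact hch.rel
  -- Basing the cycle at the last vertex of `c` makes the tail of the support exactly `c`.
  refine ⟨v, SimpleGraph.Walk.cons hadj p, ?_, by rw [← hp]; rfl⟩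
  refine SimpleGraph.Walk.IsPath.isCycle_cons (SimpleGraph.Walk.IsPath.mk' (hp ▸ hnd)) hadj ?_
  have := p.length_support
  rw [hp] at this
  omega

/-- If the parts of every sequence of `n` distinct vertices are routable, with the sizes of the
parts as capacities, then the graph is `n`-ordered. -/
theorem isKOrdered_of_routable {V β : Type*} [Fintype V] [DecidableEq V] [DecidableEq β]
    {G : SimpleGraph V} {r : β → β → Prop} (f : V → β) (hG : ∀ u v, r (f u) (f v) → G.Adj u v)
    {n : ℕ} (hn : 3 ≤ n)
    (h : ∀ l : List β, l.length = n →
      (∀ i, l.count i ≤ (Finset.univ.filter (f · = i)).card) →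
      Routable r (fun i => (Finset.univ.filter (f · = i)).card) l) :
    IsKOrdered G n := by
  intro l hnd hl
  obtain ⟨w, h1, h2, h3⟩ := h (l.map f) (by simpa using hl) (fun i => by
    rw [List.count, List.countP_map, List.countP_eq_length_filter,
      ← List.toFinset_card_of_nodup (hnd.filter _)]
    exact Finset.card_le_card fun x hx => by simpa using (by simpa using hx : _ ∧ _).2)
  obtain ⟨c, hc1, hc2, -, hc4⟩ := exists_nodup_lift f h2 l ∅ rfl hnd (by simp)
    (fun i => by simpa using h3 i)
  have hc5 : Cycle.Chain G.Adj (c : Cycle V) := by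
    rw [← hc1] at h1
    exact ((Cycle.chain_map f (s := (c : Cycle V))).mp h1).imp hG
  obtain ⟨u, p, hp, hpc⟩ := SimpleGraph.exists_isCycle_of_chain hc5 hc2
    (hn.trans (hl ▸ hc4.length_le))
  exact ⟨u, p, hp, hpc ▸ hc4⟩

/-! ### Inserting a pair of labels on the ring -/

/-- Two labels in `ZMod m` are neighbours on the ring. -/
def RingAdj (m : ℕ) (a b : ZMod m) : Prop := b = a + 1 ∨ a = b + 1

theorem RingAdj.symm {m : ℕ} (a b : ZMod m) (h : RingAdj m a b) : RingAdj m b a := Or.symm h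

theorem pair_sublist_range {i j n : ℕ} (hij : i < j) (hj : j < n) :
    [i, j].Sublist (List.range n) := by
  refine List.sublist_of_subperm_of_sortedLE (List.Nodup.subperm (by simp; omega) ?_) ?_ ?_
  · intro x hx
    simp only [List.mem_cons, List.not_mem_nil, or_false] at hx
    rw [List.mem_range]
    omega
  · exact List.Pairwise.sortedLE (by simp; omega)
  · exact List.Pairwise.sortedLE List.pairwise_le_range

theorem natCast_ne_zero_of_lt {m j : ℕ} (h0 : 0 < j) (hj : j < m) : (j : ZMod m) ≠ 0 := by
  rw [Ne, ZMod.natCast_eq_zero_iff]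
  exact fun h => absurd (Nat.le_of_dvd h0 h) (by omega)

/-- The closed walk once around the ring starting at `v`, upwards for `e = 1` and downwards for
`e = -1`. -/
def ringLoop (m : ℕ) (e v : ZMod m) : List (ZMod m) :=
  (List.range m).map fun j : ℕ => v + e * j

section

variable {m : ℕ} {e : ZMod m}

theorem chain_ringLoop (he : e = 1 ∨ e = -1) (v : ZMod m) :
    Cycle.Chain (RingAdj m) (ringLoop m e v : Cycle (ZMod m)) := by
  cases m with
  | zero => exact Cycle.Chain.nil _
  | succ n =>
    rw [ringLoop, ← Cycle.map_coe, Cycle.chain_map]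
    refine (Cycle.chain_range_succ _ n).mpr ⟨?_, fun j _ => ?_⟩
    · have h : ((n : ZMod (n + 1))) = -1 := by
        have := ZMod.natCast_self (n + 1)
        push_cast at this
        exact eq_neg_of_add_eq_zero_left this
      rw [h]
      rcases he with rfl | rfl
      · left; push_cast; ring
      · right; push_cast; ring
    · rcases he with rfl | rfl
      · left; push_cast; ring
      · right; push_cast; ring

theorem nodup_ringLoop (he : e = 1 ∨ e = -1) (v : ZMod m) : (ringLoop m e v).Nodup := by
  refine List.Nodup.map_on (fun i hi j hj hij => ?_) List.nodup_range
  rw [List.mem_range] at hi hj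
  have h : (i : ZMod m) = j := by
    rcases he with rfl | rfl
    · simpa using hij
    · simpa using hij
  rw [ZMod.natCast_eq_natCast_iff] at h
  exact Nat.ModEq.eq_of_lt_of_lt h hi hj

theorem ringLoop_eq_cons [NeZero m] (e v : ZMod m) : ∃ t, ringLoop m e v = v :: t := by
  obtain ⟨n, rfl⟩ := Nat.exists_eq_succ_of_ne_zero (NeZero.ne m)
  exact ⟨_, by rw [ringLoop, List.range_succ_eq_map]; simp; rfl⟩

theorem pair_sublist_ringLoop (e v : ZMod m) {i j : ℕ} (hij : i < j) (hj : j < m) :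
    [v + e * i, v + e * j].Sublist (ringLoop m e v) :=
  (pair_sublist_range hij hj).map fun j : ℕ => v + e * (j : ZMod m)

/-- Two distinct labels `a`, `b` appear in this order on one of the two loops from `v ≠ b`. -/
theorem exists_pair_sublist_ringLoop [NeZero m] {a b v : ZMod m} (hab : a ≠ b) (hb : b ≠ v) :
    ∃ e : ZMod m, (e = 1 ∨ e = -1) ∧ [a, b].Sublist (ringLoop m e v) := by
  have key : ∀ x : ZMod m, ∃ i < m, x = v + i := fun x =>
    ⟨(x - v).val, ZMod.val_lt _, by simp⟩
  obtain ⟨i, hi, rfl⟩ := key a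
  obtain ⟨j, hj, rfl⟩ := key b
  rcases lt_trichotomy i j with h | h | h
  · exact ⟨1, Or.inl rfl, by simpa using pair_sublist_ringLoop 1 v h hj⟩
  · exact absurd (by rw [h]) hab
  -- Downwards, offsets `i` and `j` occur at positions `m - i < m - j`. The hypothesis `b ≠ v` gives
  -- `0 < j`, so `m - j` is still a position in the loop.
  · have hj0 : 0 < j := by
      rcases Nat.eq_zero_or_pos j with rfl | h0
      · simp at hb
      · exact h0
    refine ⟨-1, Or.inr rfl, ?_⟩
    have := pair_sublist_ringLoop (-1) v (i := m - i) (j := m - j) (by omega) (by omega)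
    rw [Nat.cast_sub hi.le, Nat.cast_sub hj.le] at this
    simpa using this

/-- Neighbouring labels step away from each other; the outer labels then differ by `3`, which is
nonzero modulo `m`. Otherwise both can step upwards. This supplies two detours with no label in
common. -/
theorem exists_disjoint_ringAdj (hm : 5 ≤ m) {u v : ZMod m} (huv : u ≠ v) :
    ∃ c d, RingAdj m u c ∧ RingAdj m v d ∧ [u, c, v, d].Nodup := by
  have h1 : (1 : ZMod m) ≠ 0 := by
    simpa using natCast_ne_zero_of_lt (m := m) (j := 1) (by omega) (by omega)
  have h2 : (2 : ZMod m) ≠ 0 := by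
    simpa using natCast_ne_zero_of_lt (m := m) (j := 2) (by omega) (by omega)
  have h3 : (3 : ZMod m) ≠ 0 := by
    simpa using natCast_ne_zero_of_lt (m := m) (j := 3) (by omega) (by omega)
  by_cases hv : v = u + 1
  · subst hv
    refine ⟨u - 1, u + 2, Or.inr (by ring), Or.inl (by ring), ?_⟩
    simp only [List.nodup_cons, List.mem_cons, List.not_mem_nil, or_false, not_or, not_false_eq_true,
      List.nodup_nil, and_true]
    refine ⟨⟨fun h => h1 ?_, fun h => h1 ?_, fun h => h2 ?_⟩, ⟨fun h => h2 ?_, fun h => h3 ?_⟩,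
      fun h => h1 ?_⟩ <;> first | linear_combination h | linear_combination -h
  · by_cases hu : u = v + 1
    · subst hu
      refine ⟨v + 2, v - 1, Or.inl (by ring), Or.inr (by ring), ?_⟩
      simp only [List.nodup_cons, List.mem_cons, List.not_mem_nil, or_false, not_or,
        not_false_eq_true, List.nodup_nil, and_true]
      refine ⟨⟨fun h => h1 ?_, fun h => h1 ?_, fun h => h2 ?_⟩, ⟨fun h => h2 ?_, fun h => h3 ?_⟩,
        fun h => h1 ?_⟩ <;> first | linear_combination h | linear_combination -h
    · refine ⟨u + 1, v + 1, Or.inl rfl, Or.inl rfl, ?_⟩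
      simp only [List.nodup_cons, List.mem_cons, List.not_mem_nil, or_false, not_or,
        not_false_eq_true, List.nodup_nil, and_true]
      refine ⟨⟨fun h => h1 ?_, huv, hu⟩, ⟨fun h => hv h.symm, fun h => huv ?_⟩,
        fun h => h1 ?_⟩ <;> first | linear_combination h | linear_combination -h

namespace Routable

variable {s : ZMod m → ℕ} {a b : ZMod m}

theorem insert_pair_head [NeZero m] {v : ZMod m} {q : List (ZMod m)}
    (h : Routable (RingAdj m) s (v :: q)) (hab : a ≠ b) (hb : b ≠ v) :
    Routable (RingAdj m) (fun i => s i + 1) (a :: b :: v :: q) := by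
  obtain ⟨e, he, hsub⟩ := exists_pair_sublist_ringLoop hab hb
  obtain ⟨t, ht⟩ := ringLoop_eq_cons e v
  have hch := chain_ringLoop he v
  have hnd := nodup_ringLoop he v
  rw [ht] at hsub hch hnd
  exact (h.splice hch hsub).mono fun i =>
    Nat.add_le_add_left (List.nodup_iff_count_le_one.mp hnd i) _

/-- Two distinct labels that are consecutive in a list can be added to a routable list at the cost
of one further visit to each label. -/
theorem insert_pair (hm : 5 ≤ m) {q : List (ZMod m)} (hq : q ≠ [])
    (h : Routable (RingAdj m) s q) (hab : a ≠ b) :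
    Routable (RingAdj m) (fun i => s i + 1) (a :: b :: q) := by
  have : NeZero m := ⟨by omega⟩
  obtain ⟨v, q', rfl⟩ := List.exists_cons_of_ne_nil hq
  by_cases hb : b = v
  swap
  · exact h.insert_pair_head hab hb
  subst hb
  have hrot : ∀ (x y : ZMod m) (l : List (ZMod m)),
      List.IsRotated (x :: y :: l) (y :: (l ++ [x])) := fun x y l => by
    simpa using List.isRotated_append (l := [x]) (l' := y :: l)
  rcases List.eq_nil_or_concat q' with rfl | ⟨q, u, rfl⟩
  · have := (h.insert_pair_head hab.symm hab).reverse RingAdj.symm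
    refine this.of_isRotated ?_
    simpa using hrot b a [b]
  rw [List.concat_eq_append] at h ⊢
  -- If `a` equals the last label `u` and `b` the first, the new entries only repeat their cyclic
  -- neighbours. Two disjoint detours then suffice and add at most one visit per label.
  by_cases ha : a = u
  · subst ha
    obtain ⟨c, d, hc, hd, hnd⟩ := exists_disjoint_ringAdj hm hab
    have h1 := (h.detour RingAdj.symm hd).of_isRotated (l' := a :: b :: b :: q)
      (by simpa using (List.isRotated_append (l := b :: b :: q) (l' := [a])))
    have h2 := (h1.detour RingAdj.symm hc).of_isRotated (l' := a :: b :: b :: (q ++ [a]))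
      (by simpa using hrot a a (b :: b :: q))
    refine h2.mono fun i => ?_
    have h3 := List.nodup_iff_count_le_one.mp hnd i
    have h4 : [a, c, b, d].count i = [a, c].count i + [b, d].count i :=
      List.count_append (l₁ := [a, c]) (l₂ := [b, d])
    have h5 : s i + [b, d].count i + [a, c].count i ≤ s i + 1 := by omega
    exact h5
  -- Read backwards, the pair is `b, a`, followed by `u ≠ a`, so the full turn applies.
  · have h1 := h.reverse RingAdj.symm
    simp only [List.reverse_cons, List.reverse_append, List.reverse_nil, List.nil_append,
      List.cons_append] at h1
    have h2 := (h1.insert_pair_head hab.symm ha).reverse RingAdj.symm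
    refine h2.of_isRotated ?_
    have := List.isRotated_append (l := b :: (q ++ [u])) (l' := [a, b])
    simpa using this

end Routable

end

/-! ### Adjacent entries in cyclic lists -/

section CyclicLists

variable {α : Type*}

theorem exists_eq_append_cons_cons (p : α → Prop) (x : α) (t : List α) (hx : p x)
    (ht : ∃ y ∈ t, ¬ p y) :
    ∃ l₁ a b l₂, x :: t = l₁ ++ a :: b :: l₂ ∧ p a ∧ ¬ p b := by
  induction t generalizing x with
  | nil => simp at ht
  | cons z t ih =>
    by_cases hz : p z
    · obtain ⟨l₁, a, b, l₂, h1, h2, h3⟩ := ih z hz (by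
        obtain ⟨y, hy, hpy⟩ := ht
        rcases List.mem_cons.mp hy with rfl | hy
        · exact absurd hz hpy
        · exact ⟨y, hy, hpy⟩)
      exact ⟨x :: l₁, a, b, l₂, by rw [h1]; rfl, h2, h3⟩
    · exact ⟨[], x, z, t, rfl, hx, hz⟩

theorem isRotated_cons_cons (l₁ l₂ : List α) (a b : α) :
    List.IsRotated (l₁ ++ a :: b :: l₂) (a :: b :: (l₂ ++ l₁)) := by
  simpa using List.isRotated_append (l := l₁) (l' := a :: b :: l₂)

theorem exists_isRotated_cons {l : List α} {x : α} (hx : x ∈ l) :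
    ∃ q, List.IsRotated l (x :: q) := by
  obtain ⟨l₁, l₂, rfl⟩ := List.append_of_mem hx
  exact ⟨l₂ ++ l₁, by simpa using List.isRotated_append (l := l₁) (l' := x :: l₂)⟩

theorem exists_isRotated_cons_cons (p : α → Prop) {l : List α} {x y : α} (hx : x ∈ l) (hpx : p x)
    (hy : y ∈ l) (hpy : ¬ p y) :
    ∃ a b q, List.IsRotated l (a :: b :: q) ∧ p a ∧ ¬ p b := by
  obtain ⟨t, ht⟩ := exists_isRotated_cons hx
  have hyt : y ∈ t := by
    rcases List.mem_cons.mp (ht.mem_iff.mp hy) with rfl | h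
    · exact absurd hpx hpy
    · exact h
  obtain ⟨l₁, a, b, l₂, h1, h2, h3⟩ := exists_eq_append_cons_cons p x t hpx ⟨y, hyt, hpy⟩
  exact ⟨a, b, l₂ ++ l₁, ht.trans (h1 ▸ isRotated_cons_cons l₁ l₂ a b), h2, h3⟩

theorem exists_adjacent_of_forall_mem {i j : α} (hij : i ≠ j) {l : List α} (hi : i ∈ l)
    (hj : j ∈ l) (hl : ∀ x ∈ l, x = i ∨ x = j) :
    ∃ l₁ a b l₂, l = l₁ ++ a :: b :: l₂ ∧ (a = i ∧ b = j ∨ a = j ∧ b = i) := by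
  cases l with
  | nil => simp at hi
  | cons x t =>
    rcases hl x (by simp) with hx | hx
    · obtain ⟨l₁, a, b, l₂, h1, h2, h3⟩ := exists_eq_append_cons_cons (· = i) x t hx
        ⟨j, (List.mem_cons.mp hj).resolve_left (by rw [hx]; exact hij.symm), hij.symm⟩
      exact ⟨l₁, a, b, l₂, h1, Or.inl ⟨h2, (hl b (by rw [h1]; simp)).resolve_left h3⟩⟩
    · obtain ⟨l₁, a, b, l₂, h1, h2, h3⟩ := exists_eq_append_cons_cons (· = j) x t hx
        ⟨i, (List.mem_cons.mp hi).resolve_left (by rw [hx]; exact hij), hij⟩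
      exact ⟨l₁, a, b, l₂, h1, Or.inr ⟨h2, (hl b (by rw [h1]; simp)).resolve_right h3⟩⟩

variable [DecidableEq α]

theorem count_add_count_add_countP {i j : α} (hij : i ≠ j) (l : List α) :
    l.count i + l.count j + l.countP (fun x => x ≠ i ∧ x ≠ j) = l.length := by
  induction l with
  | nil => rfl
  | cons x l ih =>
    simp only [List.count_cons, List.countP_cons, List.length_cons, beq_iff_eq, decide_eq_true_eq]
    by_cases h1 : x = i
    · have : x ≠ j := h1 ▸ hij
      simp [h1, hij] at ih ⊢; omega
    · by_cases h2 : x = j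
      · simp [h2, hij.symm] at ih ⊢; omega
      · simp [h1, h2] at ih ⊢; omega

theorem count_add_count_add_count_le {i j t : α} (hij : i ≠ j) (hti : t ≠ i) (htj : t ≠ j)
    (l : List α) : l.count i + l.count j + l.count t ≤ l.length := by
  rw [← count_add_count_add_countP hij l]
  refine Nat.add_le_add_left (List.countP_mono_left fun x _ hx => ?_) _
  have : x = t := by simpa using hx
  simp [this, hti, htj]

/-- A cyclic list with at most two entries other than `i` and `j` either has adjacent entries
`i` and `j`, or consists of a block of `i`s and a block of `j`s separated by two other entries. -/
theorem exists_adjacent_or_isRotated_blocks {i j : α} (hij : i ≠ j) {l : List α} (hi : i ∈ l)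
    (hj : j ∈ l) (hl : l.length ≤ l.count i + l.count j + 2) :
    (∃ a b q, List.IsRotated l (a :: b :: q) ∧ (a = i ∧ b = j ∨ a = j ∧ b = i)) ∨
    (∃ x y, (x ≠ i ∧ x ≠ j) ∧ (y ≠ i ∧ y ≠ j) ∧ List.IsRotated l
      (x :: (List.replicate (l.count i) i ++ y :: List.replicate (l.count j) j))) := by
  by_cases hall : ∀ x ∈ l, x = i ∨ x = j
  · obtain ⟨l₁, a, b, l₂, rfl, h⟩ := exists_adjacent_of_forall_mem hij hi hj hall
    exact Or.inl ⟨a, b, _, isRotated_cons_cons l₁ l₂ a b, h⟩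
  push Not at hall
  obtain ⟨x, hxl, hx⟩ := hall
  obtain ⟨q, hq⟩ := exists_isRotated_cons hxl
  have hcount := count_add_count_add_countP hij l
  rw [hq.perm.countP_eq, List.countP_cons_of_pos (by simpa using hx)] at hcount
  have hiq : i ∈ q := (List.mem_cons.mp (hq.mem_iff.mp hi)).resolve_left hx.1.symm
  have hjq : j ∈ q := (List.mem_cons.mp (hq.mem_iff.mp hj)).resolve_left hx.2.symm
  by_cases hall : ∀ x ∈ q, x = i ∨ x = j
  · obtain ⟨l₁, a, b, l₂, rfl, h⟩ := exists_adjacent_of_forall_mem hij hiq hjq hall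
    exact Or.inl ⟨a, b, _, hq.trans (isRotated_cons_cons (x :: l₁) l₂ a b), h⟩
  push Not at hall
  obtain ⟨y, hyq, hy⟩ := hall
  obtain ⟨q₁, q₂, rfl⟩ := List.append_of_mem hyq
  rw [List.countP_append, List.countP_cons_of_pos (by simpa using hy)] at hcount
  have hall₁ : ∀ z ∈ q₁, z = i ∨ z = j := by
    have h0 : q₁.countP (fun x => x ≠ i ∧ x ≠ j) = 0 := by omega
    intro z hz
    have := List.countP_eq_zero.mp h0 z hz
    simp only [decide_eq_true_eq] at this
    tauto
  have hall₂ : ∀ z ∈ q₂, z = i ∨ z = j := by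
    have h0 : q₂.countP (fun x => x ≠ i ∧ x ≠ j) = 0 := by omega
    intro z hz
    have := List.countP_eq_zero.mp h0 z hz
    simp only [decide_eq_true_eq] at this
    tauto
  have hci := hq.perm.count_eq i
  have hcj := hq.perm.count_eq j
  simp only [List.count_cons_of_ne hx.1, List.count_cons_of_ne hx.2, List.count_append,
    List.count_cons_of_ne hy.1, List.count_cons_of_ne hy.2] at hci hcj
  have hiq' : i ∈ q₁ ∨ i ∈ q₂ := by
    simpa [hy.1.symm] using hiq
  have hjq' : j ∈ q₁ ∨ j ∈ q₂ := by
    simpa [hy.2.symm] using hjq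
  -- `x` and `y` cut the cyclic list into arcs `q₁`, `q₂` of `i`s and `j`s. An arc containing both
  -- labels has them adjacent; otherwise each arc is constant.
  by_cases h1 : i ∈ q₁ ∧ j ∈ q₁
  · obtain ⟨l₁, a, b, l₂, rfl, h⟩ := exists_adjacent_of_forall_mem hij h1.1 h1.2 hall₁
    refine Or.inl ⟨a, b, (l₂ ++ y :: q₂) ++ x :: l₁, hq.trans ?_, h⟩
    simpa using isRotated_cons_cons (x :: l₁) (l₂ ++ y :: q₂) a b
  by_cases h2 : i ∈ q₂ ∧ j ∈ q₂
  · obtain ⟨l₁, a, b, l₂, rfl, h⟩ := exists_adjacent_of_forall_mem hij h2.1 h2.2 hall₂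
    refine Or.inl ⟨a, b, l₂ ++ x :: (q₁ ++ y :: l₁), hq.trans ?_, h⟩
    simpa using isRotated_cons_cons (x :: (q₁ ++ y :: l₁)) l₂ a b
  have hrep : ∀ (c d : α) (p : List α), (∀ z ∈ p, z = c ∨ z = d) → d ∉ p →
      p = List.replicate (p.count c) c := fun c d p hp hd => by
    have : ∀ z ∈ p, z = c := fun z hz => (hp z hz).resolve_right fun h => hd (h ▸ hz)
    rw [List.count_eq_length.mpr fun z hz => (this z hz).symm]
    exact List.eq_replicate_of_mem this
  right
  by_cases h3 : j ∈ q₁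
  · have hi1 : i ∉ q₁ := fun h => h1 ⟨h, h3⟩
    have hi2 : i ∈ q₂ := hiq'.resolve_left hi1
    have hj2 : j ∉ q₂ := fun h => h2 ⟨hi2, h⟩
    refine ⟨y, x, hy, hx, ?_⟩
    rw [hci, hcj, List.count_eq_zero.mpr hi1, List.count_eq_zero.mpr hj2, Nat.zero_add,
      Nat.add_zero, ← hrep i j q₂ hall₂ hj2,
      ← hrep j i q₁ (fun z hz => (hall₁ z hz).symm) hi1]
    refine hq.trans ?_
    simpa using List.isRotated_append (l := x :: q₁) (l' := y :: q₂)
  · have hj2 : j ∈ q₂ := hjq'.resolve_left h3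
    have hi2 : i ∉ q₂ := fun h => h2 ⟨h, hj2⟩
    refine ⟨x, y, hx, hy, ?_⟩
    rw [hci, hcj, List.count_eq_zero.mpr hi2, List.count_eq_zero.mpr h3, Nat.zero_add,
      Nat.add_zero, ← hrep i j q₁ hall₁ h3,
      ← hrep j i q₂ (fun z hz => (hall₂ z hz).symm) hi2]
    exact hq

end CyclicLists

/-! ### Repeated detours and up-and-down walks -/

theorem Routable.detour_iterate {β : Type*} [DecidableEq β] {r : β → β → Prop} {s : β → ℕ}
    (hr : ∀ a b, r a b → r b a) {c d : β} {q : List β} (h : Routable r s (c :: q))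
    (hcd : r c d) (n : ℕ) :
    Routable r (fun i => s i + n * [c, d].count i) (List.replicate n c ++ c :: q) := by
  induction n with
  | zero => simpa using h
  | succ n ih =>
    have h1 : List.replicate n c ++ c :: q = c :: (List.replicate n c ++ q) := by
      rw [← List.cons_append, ← List.replicate_succ, List.replicate_succ', List.append_assoc]
      rfl
    rw [h1] at ih
    rw [List.replicate_succ, List.cons_append, h1]
    refine (ih.detour hr hcd).mono fun i => le_of_eq ?_
    ring

section UpDown

variable {m : ℕ}

theorem natCast_eq_iff_val_eq [NeZero m] {a : ℕ} (ha : a < m) (i : ZMod m) :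
    (a : ZMod m) = i ↔ i.val = a :=
  ⟨fun h => by rw [← h, ZMod.val_natCast_of_lt ha], fun h => by rw [← h, ZMod.natCast_zmod_val]⟩

/-- The closed walk `p, p + 1, …, p + d, p + d - 1, …, p + 1`. -/
def upDownWalk (m p d : ℕ) : List (ZMod m) :=
  (List.range' p d ++ (List.range' (p + 1) d).reverse).map Nat.cast

theorem chain_upDownWalk {p d : ℕ} (hd : 0 < d) :
    Cycle.Chain (RingAdj m) (upDownWalk m p d : Cycle (ZMod m)) := by
  rw [upDownWalk, ← Cycle.map_coe, Cycle.chain_map]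
  have hup : List.IsChain (fun a b : ℕ => RingAdj m (a : ZMod m) b) (List.range' p (d + 1)) :=
    (List.isChain_range' p (d + 1) 1).imp fun a b h => Or.inl (by rw [h]; push_cast; ring)
  have hdown := List.isChain_reverse.mpr (hup.imp fun a b h => RingAdj.symm (m := m) _ _ h)
  have hconcat : List.range' p (d + 1) = List.range' p d ++ [p + d] := by
    simpa using List.range'_concat (s := p) (n := d) (step := 1)
  obtain ⟨n, rfl⟩ := Nat.exists_eq_succ_of_ne_zero hd.ne'
  rw [List.range'_succ (s := p) (n := n), List.cons_append, Cycle.chain_coe_cons]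
  -- The ascent and its reversal are glued at the turning point `p + d`.
  have h := List.isChain_split.mpr ⟨by simpa [hconcat] using hup, by
    simpa [hconcat] using hdown⟩
  have h2 : List.range' p (n + 1) ++ (p + (n + 1)) :: (List.range' p (n + 1)).reverse =
      p :: (List.range' (p + 1) n ++ (List.range' (p + 1) (n + 1)).reverse ++ [p]) := by
    have : (p + (n + 1)) :: (List.range' p (n + 1)).reverse =
        (List.range' (p + 1) (n + 1)).reverse ++ [p] := by
      have h3 := congrArg List.reverse hconcat
      rw [List.range'_succ] at h3
      simpa using h3.symm
    rw [this, List.range'_succ]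
    simp
  rw [← h2]
  exact h

theorem count_map_range'_le {p d : ℕ} (hd : d ≤ m) (i : ZMod m) :
    ((List.range' p d).map (Nat.cast : ℕ → ZMod m)).count i ≤ 1 := by
  refine List.nodup_iff_count_le_one.mp (List.Nodup.map_on (fun a ha b hb hab => ?_)
    List.nodup_range') i
  rw [List.mem_range'_1] at ha hb
  rw [ZMod.natCast_eq_natCast_iff] at hab
  rcases lt_trichotomy a b with h | h | h
  · have := Nat.le_of_dvd (by omega) ((Nat.modEq_iff_dvd' h.le).mp hab)
    omega
  · exact h
  · have := Nat.le_of_dvd (by omega) ((Nat.modEq_iff_dvd' h.le).mp hab.symm)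
    omega

end UpDown

/-! ### Capacities and the induction on `k` -/

/-- The part sizes of `P_{k,m}`, indexed by `ZMod m`. -/
def ringSize (k m : ℕ) (i : ZMod m) : ℕ :=
  if i.val ≤ 1 then k - 1 else if i.val = 2 then k else k + 1

section

variable {m : ℕ}

theorem ringSize_succ {k : ℕ} (hk : 1 ≤ k) (i : ZMod m) :
    ringSize (k + 1) m i = ringSize k m i + 1 := by
  unfold ringSize
  split_ifs <;> omega

theorem count_pair [NeZero m] {a b : ℕ} (ha : a < m) (hb : b < m) (i : ZMod m) :
    [(a : ZMod m), (b : ZMod m)].count i =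
      (if i.val = a then 1 else 0) + (if i.val = b then 1 else 0) := by
  simp only [List.count_cons, List.count_nil, beq_iff_eq, natCast_eq_iff_val_eq ha,
    natCast_eq_iff_val_eq hb]
  omega

theorem count_map_range'_eq_zero {p d : ℕ} {i : ZMod m}
    (h : ∀ j, p ≤ j → j < p + d → (j : ZMod m) ≠ i) :
    ((List.range' p d).map (Nat.cast : ℕ → ZMod m)).count i = 0 := by
  refine List.count_eq_zero.mpr fun hmem => ?_
  obtain ⟨j, hj, rfl⟩ := List.mem_map.mp hmem
  rw [List.mem_range'_1] at hj
  exact h j hj.1 hj.2 rfl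

theorem count_upDownWalk (p d : ℕ) (i : ZMod m) :
    (upDownWalk m p d).count i = ((List.range' p d).map (Nat.cast : ℕ → ZMod m)).count i +
      ((List.range' (p + 1) d).map (Nat.cast : ℕ → ZMod m)).count i := by
  rw [upDownWalk, List.map_append, List.count_append, List.map_reverse, List.count_reverse]

/-- Going up from `p` to `q` and back never reaches the empty parts `0` and `1`. Label `2`, of
capacity one, can occur only as the lower turning point, visited once. -/
theorem routable_pair_of_lt [NeZero m] {p q : ZMod m} (hp : 2 ≤ p.val) (hpq : p.val < q.val) :
    Routable (RingAdj m) (ringSize 1 m) [p, q] := by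
  have hq := ZMod.val_lt q
  obtain ⟨d, hd⟩ := Nat.exists_eq_add_of_lt hpq
  refine ⟨upDownWalk m p.val (d + 1), chain_upDownWalk (by omega), ?_, fun i => ?_⟩
  · rw [upDownWalk, List.map_append]
    refine List.Sublist.append (l₁ := [p]) (r₁ := [q]) ?_ ?_
    · rw [List.singleton_sublist, List.mem_map]
      exact ⟨p.val, by simp, by simp⟩
    · rw [List.singleton_sublist, List.mem_map]
      exact ⟨q.val, by simp [List.mem_range'_1]; omega, by simp⟩
  · rw [count_upDownWalk]
    have h1 := count_map_range'_le (p := p.val) (d := d + 1) (by omega) i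
    have h2 := count_map_range'_le (p := p.val + 1) (d := d + 1) (by omega) i
    have h3 : i.val < 2 → ((List.range' p.val (d + 1)).map (Nat.cast : ℕ → ZMod m)).count i = 0 :=
      fun hi => count_map_range'_eq_zero fun j hj hj' h => by
        rw [natCast_eq_iff_val_eq (by omega)] at h; omega
    have h4 : i.val < 3 →
        ((List.range' (p.val + 1) (d + 1)).map (Nat.cast : ℕ → ZMod m)).count i = 0 :=
      fun hi => count_map_range'_eq_zero fun j hj hj' h => by
        rw [natCast_eq_iff_val_eq (by omega)] at h; omega
    unfold ringSize
    split_ifs <;> omega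

theorem routable_of_length_two (hm : 5 ≤ m) {l : List (ZMod m)} (hl : l.length = 2)
    (hcount : ∀ i, l.count i ≤ ringSize 1 m i) : Routable (RingAdj m) (ringSize 1 m) l := by
  have : NeZero m := ⟨by omega⟩
  obtain ⟨p, q, rfl⟩ := List.length_eq_two.mp hl
  have hp := hcount p
  have hq := hcount q
  rcases lt_trichotomy p.val q.val with h | h | h
  · refine routable_pair_of_lt ?_ h
    by_contra! h2
    rw [List.count_cons_self, ringSize, if_pos (by omega)] at hp
    omega
  · obtain rfl := ZMod.val_injective m h
    have hp3 : 3 ≤ p.val := by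
      by_contra! h3
      simp only [List.count_cons_self, ringSize] at hp
      split_ifs at hp <;> simp at hp
      omega
    have hpm := ZMod.val_lt p
    -- A repeated label needs capacity two, hence `3 ≤ p.val`. Walking `p, a, p, a` needs a
    -- neighbour that also has capacity two.
    obtain ⟨a, ha3, ham, hap, hadj⟩ : ∃ a : ℕ, 3 ≤ a ∧ a < m ∧ a ≠ p.val ∧ RingAdj m p (a : ℕ) := by
      by_cases h3 : p.val = 3
      · refine ⟨4, by omega, by omega, by omega, Or.inl ?_⟩
        rw [← ZMod.natCast_zmod_val p, h3]
        norm_num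
      · refine ⟨p.val - 1, by omega, by omega, by omega, Or.inr ?_⟩
        rw [Nat.cast_sub (by omega)]
        simp
    have h0 : Routable (RingAdj m) (fun i => [p, (a : ZMod m)].count i) [p] :=
      ⟨[p, (a : ZMod m)], by simpa using ⟨hadj, RingAdj.symm _ _ hadj⟩, by simp, fun i => le_rfl⟩
    refine (h0.detour RingAdj.symm hadj).mono fun i => ?_
    have hc := count_pair hpm ham i
    rw [ZMod.natCast_zmod_val] at hc
    simp only [hc, ringSize]
    split_ifs <;> omega
  · refine (routable_pair_of_lt ?_ h).reverse RingAdj.symm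
    by_contra! h2
    rw [ringSize, if_pos (by omega)] at hq
    simp [List.count_cons] at hq

/-- Blocks of labels `0` and `1` of full size, separated by two other labels, are routable. -/
theorem routable_blocks (hm : 5 ≤ m) {k : ℕ} (hk : 1 ≤ k) {x y : ZMod m}
    (hx : 2 ≤ x.val) (hy : 2 ≤ y.val) :
    Routable (RingAdj m) (ringSize (k + 1) m)
      (x :: (List.replicate k 0 ++ y :: List.replicate k 1)) := by
  have : NeZero m := ⟨by omega⟩
  obtain ⟨n, rfl⟩ := Nat.exists_eq_add_of_le' hk
  have hxm := ZMod.val_lt x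
  have hym := ZMod.val_lt y
  -- Walk `1, 2, …, m - 1, 0, m - 1, …, 2`: labels `0` and `1` are the turning points, and every
  -- other label is met once on each way. The remaining copies of `1` and `0` come from detours to
  -- `2` and `m - 1`; the capacities of `0`, `1` and `2` are used up exactly.
  have base : Routable (RingAdj m) (fun i => if i.val ≤ 1 then 1 else 2) [1, x, 0, y] := by
    refine ⟨upDownWalk m 1 (m - 1), chain_upDownWalk (by omega), ?_, fun i => ?_⟩
    · rw [upDownWalk, List.map_append]
      refine List.Sublist.append (l₁ := [1, x]) (r₁ := [0, y]) ?_ ?_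
      · obtain ⟨d, hd⟩ : ∃ d, m - 1 = d + 1 := ⟨m - 2, by omega⟩
        rw [hd, List.range'_succ, List.map_cons, Nat.cast_one]
        refine List.Sublist.cons_cons 1 ?_
        rw [List.singleton_sublist, List.mem_map]
        exact ⟨x.val, by rw [List.mem_range'_1]; omega, by simp⟩
      · obtain ⟨d, hd⟩ : ∃ d, m - 1 = d + 1 := ⟨m - 2, by omega⟩
        have h0 : ((1 + 1 + d : ℕ) : ZMod m) = 0 := by
          rw [show 1 + 1 + d = m by omega, ZMod.natCast_self]
        rw [hd, List.range'_concat, List.reverse_append, List.reverse_singleton,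
          List.singleton_append, List.map_cons, Nat.one_mul, h0]
        refine List.Sublist.cons_cons 0 ?_
        rw [List.singleton_sublist, List.mem_map]
        exact ⟨y.val, by rw [List.mem_reverse, List.mem_range'_1]; omega, by simp⟩
    · rw [count_upDownWalk]
      have h1 := count_map_range'_le (p := 1) (d := m - 1) (by omega) i
      have h2 := count_map_range'_le (p := 1 + 1) (d := m - 1) (by omega) i
      have h3 : i.val = 0 → ((List.range' 1 (m - 1)).map (Nat.cast : ℕ → ZMod m)).count i = 0 :=
        fun hi => count_map_range'_eq_zero fun j hj hj' h => by
          rw [natCast_eq_iff_val_eq (by omega)] at h; omega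
      have h4 : i.val = 1 →
          ((List.range' (1 + 1) (m - 1)).map (Nat.cast : ℕ → ZMod m)).count i = 0 :=
        fun hi => count_map_range'_eq_zero fun j hj hj' h => by
          rcases Nat.lt_or_ge j m with hjm | hjm
          · rw [natCast_eq_iff_val_eq hjm] at h; omega
          · rw [show j = m by omega, ZMod.natCast_self] at h
            rw [← h, ZMod.val_zero] at hi
            omega
      dsimp only
      split_ifs <;> omega
  have h12 : RingAdj m 1 ((2 : ℕ) : ZMod m) := Or.inl (by norm_num)
  have h0m : RingAdj m 0 ((m - 1 : ℕ) : ZMod m) := by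
    right
    rw [Nat.cast_sub (by omega)]
    simp
  have hones := (base.detour_iterate RingAdj.symm h12 n).of_isRotated
    (l' := 0 :: (y :: (List.replicate n 1 ++ [1, x]))) (by
      have := List.isRotated_append (l := List.replicate n (1 : ZMod m) ++ [1, x]) (l' := [0, y])
      rwa [List.append_assoc] at this)
  have hzeros := (hones.detour_iterate RingAdj.symm h0m n).of_isRotated
    (l' := x :: (List.replicate (n + 1) 0 ++ y :: List.replicate (n + 1) 1)) (by
      rw [List.replicate_succ', List.replicate_succ']
      have := List.isRotated_append
        (l := List.replicate n (0 : ZMod m) ++ 0 :: (y :: (List.replicate n 1 ++ [1]))) (l' := [x])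
      simpa only [List.append_assoc, List.cons_append, List.nil_append] using this)
  refine hzeros.mono fun i => ?_
  have hc1 := count_pair (m := m) (a := 1) (b := 2) (by omega) (by omega) i
  have hc2 := count_pair (m := m) (a := 0) (b := m - 1) (by omega) (by omega) i
  rw [Nat.cast_one] at hc1
  rw [Nat.cast_zero] at hc2
  simp only [hc1, hc2, ringSize]
  split_ifs <;> omega

/-- The sequences of length four that fill the three smallest parts of `P_{2,m}`. -/
theorem routable_of_three_full (hm : 5 ≤ m) {l : List (ZMod m)} (hl : l.length = 4)
    (h0 : l.count 0 = 1) (h1 : l.count 1 = 1) (h2 : l.count 2 = 2) :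
    Routable (RingAdj m) (ringSize 2 m) l := by
  have : NeZero m := ⟨by omega⟩
  have : Fact (1 < m) := ⟨by omega⟩
  have hv2 : (2 : ZMod m).val = 2 := by
    have := ZMod.val_natCast_of_lt (n := m) (a := 2) (by omega)
    simpa using this
  have h01 : (0 : ZMod m) ≠ 1 := zero_ne_one
  have h02 : (0 : ZMod m) ≠ 2 := fun h => by
    have := congrArg ZMod.val h
    rw [hv2, ZMod.val_zero] at this
    omega
  have h12 : (1 : ZMod m) ≠ 2 := fun h => by
    have := congrArg ZMod.val h
    rw [hv2, ZMod.val_one] at this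
    omega
  -- One turn around the ring, with a detour from `2` to `3` for the second `2`.
  have key : Routable (RingAdj m) (ringSize 2 m) [2, 2, 0, 1] := by
    have h3 : Routable (RingAdj m) (fun _ => 1) [0, 1, 2] := by
      refine ⟨ringLoop m 1 0, chain_ringLoop (Or.inl rfl) 0, ?_,
        List.nodup_iff_count_le_one.mp (nodup_ringLoop (Or.inl rfl) 0)⟩
      have := (List.range_sublist.mpr (show 3 ≤ m by omega)).map
        fun j : ℕ => (0 : ZMod m) + 1 * (j : ZMod m)
      simpa [List.range_succ, ringLoop] using this
    have h4 := (h3.of_isRotated (l' := [2, 0, 1])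
      (List.isRotated_append (l := [0, 1]) (l' := [2]))).detour RingAdj.symm
      (d := ((3 : ℕ) : ZMod m)) (Or.inl (by norm_num))
    refine h4.mono fun i => ?_
    have hc := count_pair (m := m) (a := 2) (b := 3) (by omega) (by omega) i
    rw [Nat.cast_two] at hc
    simp only [hc, ringSize]
    split_ifs <;> omega
  obtain ⟨q, hq⟩ := exists_isRotated_cons (List.count_pos_iff.mp (by omega : 0 < l.count 0))
  refine Routable.of_isRotated ?_ hq.symm
  rw [hq.perm.length_eq] at hl
  rw [hq.perm.count_eq, List.count_cons_of_ne h01] at h1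
  rw [hq.perm.count_eq, List.count_cons_of_ne h02] at h2
  obtain ⟨q₁, q₂, rfl⟩ := List.append_of_mem (List.count_pos_iff.mp (by omega : 0 < q.count 1))
  simp only [List.length_cons, List.length_append] at hl
  rw [List.count_append, List.count_cons_of_ne h12] at h2
  have hle₁ := q₁.count_le_length (a := 2)
  have hle₂ := q₂.count_le_length (a := 2)
  have hrep : ∀ p : List (ZMod m), p.count 2 = p.length → p = List.replicate p.length 2 :=
    fun p hp => List.eq_replicate_of_mem fun z hz => (List.count_eq_length.mp hp z hz).symm
  rw [hrep q₁ (by omega), hrep q₂ (by omega)]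
  -- The two `2`s lie together on one side of the pair `0, 1`, which is `key` or its reversal, or
  -- are separated, which is a case of `routable_blocks`.
  obtain h | h | h : (q₁.length = 0 ∧ q₂.length = 2) ∨ (q₁.length = 1 ∧ q₂.length = 1) ∨
      (q₁.length = 2 ∧ q₂.length = 0) := by omega
  · rw [h.1, h.2]
    exact key.of_isRotated (List.isRotated_append (l := [2, 2]) (l' := [0, 1]))
  · rw [h.1, h.2]
    exact (routable_blocks hm le_rfl hv2.ge hv2.ge).of_isRotated
      (List.isRotated_append (l := [2]) (l' := [0, 2, 1]))
  · rw [h.1, h.2]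
    exact (key.reverse RingAdj.symm).of_isRotated
      (List.isRotated_append (l := [1]) (l' := [0, 2, 2]))

theorem val_ne_of_ne {i j : ZMod m} [NeZero m] (h : i ≠ j) : i.val ≠ j.val :=
  fun h' => h (ZMod.val_injective m h')

/-- A label is saturated when its count is `ringSize k m i + 1`. A removable pair must contain all
saturated labels; the cases follow how many there are. -/
theorem routable_succ (hm : 5 ≤ m) {k : ℕ} (hk : 1 ≤ k)
    (ih : ∀ l : List (ZMod m), l.length = 2 * k → (∀ i, l.count i ≤ ringSize k m i) →
      Routable (RingAdj m) (ringSize k m) l)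
    {l : List (ZMod m)} (hl : l.length = 2 * (k + 1))
    (hcount : ∀ i, l.count i ≤ ringSize (k + 1) m i) :
    Routable (RingAdj m) (ringSize (k + 1) m) l := by
  have : NeZero m := ⟨by omega⟩
  have : Fact (1 < m) := ⟨by omega⟩
  have remove : ∀ a b q, List.IsRotated l (a :: b :: q) → a ≠ b →
      (∀ i, q.count i ≤ ringSize k m i) → Routable (RingAdj m) (ringSize (k + 1) m) l := by
    intro a b q hrot hab hq
    have hlen : q.length = 2 * k := by
      have := hrot.perm.length_eq
      simp only [List.length_cons] at this
      omega
    have hne : q ≠ [] := fun h => by simp [h] at hlen; omega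
    exact (((ih q hlen hq).insert_pair hm hne hab).mono
      fun i => (ringSize_succ hk i).ge).of_isRotated hrot.symm
  simp only [ringSize_succ hk] at hcount
  by_cases htwo : ∃ i j, i ≠ j ∧ l.count i = ringSize k m i + 1 ∧ l.count j = ringSize k m j + 1
  · obtain ⟨i, j, hij, hi, hj⟩ := htwo
    have hvij := val_ne_of_ne hij
    have hsum := count_add_count_add_countP hij l
    have hlb : ∀ t : ZMod m, k - 1 ≤ ringSize k m t := fun t => by
      unfold ringSize; split_ifs <;> omega
    have hli := hlb i
    have hlj := hlb j
    rcases exists_adjacent_or_isRotated_blocks hij (List.count_pos_iff.mp (by omega))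
      (List.count_pos_iff.mp (by omega)) (by omega : l.length ≤ l.count i + l.count j + 2) with
      ⟨a, b, q, hrot, hab⟩ | ⟨x, y, hx, hy, hrot⟩
    · by_cases hthree : ∃ t, t ≠ i ∧ t ≠ j ∧ l.count t = ringSize k m t + 1
      · obtain ⟨t, hti, htj, ht⟩ := hthree
        have hvti := val_ne_of_ne hti
        have hvtj := val_ne_of_ne htj
        have hle := count_add_count_add_count_le hij hti htj l
        rw [hi, hj, ht, hl] at hle
        -- Three distinct parts have total size at least `3k - 2` at level `k`, while the length
        -- leaves at most `2k - 1`.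
        have hall : k = 1 ∧ i.val ≤ 2 ∧ j.val ≤ 2 ∧ t.val ≤ 2 := by
          unfold ringSize at hle
          split_ifs at hle <;> omega
        obtain ⟨rfl, hi2, hj2, ht2⟩ := hall
        have hfull : ∀ z : ZMod m, z.val ≤ 2 → l.count z = ringSize 1 m z + 1 := fun z hz => by
          obtain h | h | h : z.val = i.val ∨ z.val = j.val ∨ z.val = t.val := by omega
          · rw [ZMod.val_injective m h, hi]
          · rw [ZMod.val_injective m h, hj]
          · rw [ZMod.val_injective m h, ht]
        have hv2 : (2 : ZMod m).val = 2 := by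
          have := ZMod.val_natCast_of_lt (n := m) (a := 2) (by omega)
          simpa using this
        refine routable_of_three_full hm hl ?_ ?_ ?_
        · rw [hfull 0 (by simp), ringSize, if_pos (by simp)]
        · rw [hfull 1 (by rw [ZMod.val_one]; omega), ringSize, if_pos (by rw [ZMod.val_one])]
        · rw [hfull 2 hv2.le, ringSize, if_neg (by omega), if_pos hv2]
      · push Not at hthree
        refine remove a b q hrot ?_ fun t => ?_
        · rcases hab with ⟨rfl, rfl⟩ | ⟨rfl, rfl⟩
          · exact hij
          · exact hij.symm
        · have hc := hrot.perm.count_eq t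
          simp only [List.count_cons, beq_iff_eq] at hc
          have ht := hcount t
          by_cases h1 : t = i
          · rcases hab with ⟨rfl, rfl⟩ | ⟨rfl, rfl⟩
            · rw [if_pos h1.symm] at hc; omega
            · rw [if_pos h1.symm] at hc; omega
          · by_cases h2 : t = j
            · rcases hab with ⟨rfl, rfl⟩ | ⟨rfl, rfl⟩
              · rw [if_pos h2.symm] at hc; omega
              · rw [if_pos h2.symm] at hc; omega
            · have := hthree t h1 h2
              omega
    · have hlen := hrot.perm.length_eq
      simp only [List.length_cons, List.length_append, List.length_replicate] at hlen
      -- Two saturated labels and two separators make up all `2k + 2` entries, so both parts have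
      -- the minimal size `k - 1`.
      have hsmall : i.val ≤ 1 ∧ j.val ≤ 1 := by
        rw [hi, hj, hl] at hlen
        unfold ringSize at hlen
        split_ifs at hlen <;> omega
      have hci : l.count i = k := by rw [hi, ringSize, if_pos hsmall.1]; omega
      have hcj : l.count j = k := by rw [hj, ringSize, if_pos hsmall.2]; omega
      rw [hci, hcj] at hrot
      have hvxi := val_ne_of_ne hx.1
      have hvxj := val_ne_of_ne hx.2
      have hvyi := val_ne_of_ne hy.1
      have hvyj := val_ne_of_ne hy.2
      obtain ⟨h0, h1⟩ | ⟨h0, h1⟩ : (i.val = 0 ∧ j.val = 1) ∨ (j.val = 0 ∧ i.val = 1) := by omega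
      · obtain rfl : i = 0 := ZMod.val_injective m (by rw [h0, ZMod.val_zero])
        obtain rfl : j = 1 := ZMod.val_injective m (by rw [h1, ZMod.val_one])
        exact (routable_blocks hm hk (by omega) (by omega)).of_isRotated hrot.symm
      · obtain rfl : j = 0 := ZMod.val_injective m (by rw [h0, ZMod.val_zero])
        obtain rfl : i = 1 := ZMod.val_injective m (by rw [h1, ZMod.val_one])
        refine (routable_blocks (x := y) (y := x) hm hk (by omega) (by omega)).of_isRotated
          (List.IsRotated.trans ?_ hrot.symm)
        simpa using List.isRotated_append (l := y :: List.replicate k 0)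
          (l' := x :: List.replicate k 1)
  · push Not at htwo
    have hne : l ≠ [] := fun h => by simp [h] at hl
    obtain ⟨i, hil, hi⟩ : ∃ i ∈ l, ∀ t, t ≠ i → l.count t ≤ ringSize k m t := by
      by_cases hone : ∃ i, l.count i = ringSize k m i + 1
      · obtain ⟨i, hi⟩ := hone
        refine ⟨i, List.count_pos_iff.mp (by omega), fun t ht => ?_⟩
        have := htwo i t ht.symm hi
        have := hcount t
        omega
      · push Not at hone
        obtain ⟨i, t, rfl⟩ := List.exists_cons_of_ne_nil hne
        refine ⟨i, by simp, fun t _ => ?_⟩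
        have := hone t
        have := hcount t
        omega
    -- One label occurs at most `k + 2` times, fewer than the `2k + 2` entries.
    obtain ⟨j, hjl, hji⟩ : ∃ j ∈ l, j ≠ i := by
      by_contra! hcon
      have h1 := List.count_eq_length.mpr fun z hz => (hcon z hz).symm
      have h2 := hcount i
      unfold ringSize at h2
      split_ifs at h2 <;> omega
    obtain ⟨a, b, q, hrot, rfl, hb⟩ := exists_isRotated_cons_cons (· = i) hil rfl hjl hji
    refine remove a b q hrot (fun h => hb h.symm) fun t => ?_
    have hc := hrot.perm.count_eq t
    simp only [List.count_cons, beq_iff_eq] at hc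
    by_cases h1 : t = a
    · rw [if_pos h1.symm] at hc
      have := hcount t
      omega
    · have := hi t h1
      omega

theorem routable_of_count_le (hm : 5 ≤ m) {k : ℕ} (hk : 1 ≤ k) :
    ∀ l : List (ZMod m), l.length = 2 * k → (∀ i, l.count i ≤ ringSize k m i) →
      Routable (RingAdj m) (ringSize k m) l := by
  induction k, hk using Nat.le_induction with
  | base => exact fun l hl hcount => routable_of_length_two hm hl hcount
  | succ k hk ih => exact fun l hl hcount => routable_succ hm hk ih hl hcount

end

/-! ### Adjacency, degrees and the number of vertices -/

theorem cyclicAdj_iff_ringAdj {m : ℕ} (i j : Fin m) :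
    CyclicAdj m i j ↔ RingAdj m ((i : ℕ) : ZMod m) ((j : ℕ) : ZMod m) := by
  unfold CyclicAdj RingAdj
  rw [← ZMod.intCast_eq_intCast_iff, ← ZMod.intCast_eq_intCast_iff]
  push_cast
  rw [or_comm]
  refine or_congr ⟨fun h => ?_, fun h => ?_⟩ ⟨fun h => ?_, fun h => ?_⟩
  · linear_combination -h
  · linear_combination -h
  · linear_combination h
  · linear_combination h

theorem cyclicAdj_iff {m : ℕ} (i j : Fin m) :
    CyclicAdj m i j ↔ (i : ℕ) + 1 = j ∨ (j : ℕ) + 1 = i ∨ ((i : ℕ) = 0 ∧ (j : ℕ) + 1 = m) ∨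
      ((j : ℕ) = 0 ∧ (i : ℕ) + 1 = m) := by
  have hi := i.isLt
  have hj := j.isLt
  unfold CyclicAdj
  rw [Int.modEq_iff_dvd, Int.modEq_iff_dvd]
  constructor
  -- Differences of indices, shifted by one, stay within `[-m, m]`, so only the multiples `-m`, `0`,
  -- `m` are possible.
  · have key : ∀ c x : ℤ, x = m * c → -(m : ℤ) ≤ x → x ≤ m → x = -m ∨ x = 0 ∨ x = m := by
      intro c x hx h1 h2
      obtain h | h | h | h | h : c ≤ -2 ∨ c = -1 ∨ c = 0 ∨ c = 1 ∨ 2 ≤ c := by omega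
      · nlinarith
      · subst h; omega
      · subst h; omega
      · subst h; omega
      · nlinarith
    rintro (⟨c, hc⟩ | ⟨c, hc⟩)
    · have := key c _ hc (by omega) (by omega)
      omega
    · have := key c _ hc (by omega) (by omega)
      omega
  · rintro (h | h | ⟨h, h'⟩ | ⟨h, h'⟩)
    · exact Or.inr ⟨0, by omega⟩
    · exact Or.inl ⟨0, by omega⟩
    · exact Or.inl ⟨1, by omega⟩
    · exact Or.inr ⟨-1, by omega⟩

theorem card_filter_sigma_fst {ι : Type*} [Fintype ι] (size : ι → ℕ) (p : ι → Prop)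
    [DecidablePred p] :
    (Finset.univ.filter fun v : Σ i, Fin (size i) => p v.1).card =
      ∑ i ∈ Finset.univ.filter p, size i := by
  have : (Finset.univ.filter fun v : Σ i, Fin (size i) => p v.1) =
      (Finset.univ.filter p).sigma fun _ => Finset.univ := by
    ext v
    simp
  rw [this, Finset.card_sigma]
  simp

theorem braceletGraph_adj_iff {m : ℕ} (hm : 3 ≤ m) (size : Fin m → ℕ)
    (u v : Σ i : Fin m, Fin (size i)) :
    (braceletGraph size).Adj u v ↔ CyclicAdj m u.1 v.1 := by
  refine ⟨fun h => h.2, fun h => ⟨?_, h⟩⟩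
  rintro rfl
  rw [cyclicAdj_iff] at h
  omega

theorem degree_braceletGraph {m : ℕ} (hm : 3 ≤ m) (size : Fin m → ℕ)
    (v : Σ i : Fin m, Fin (size i)) {a b : Fin m} (hab : a ≠ b)
    (h : ∀ i, CyclicAdj m v.1 i ↔ i = a ∨ i = b) :
    (braceletGraph size).degree v = size a + size b := by
  rw [← SimpleGraph.card_neighborFinset_eq_degree, SimpleGraph.neighborFinset_eq_filter]
  simp only [braceletGraph_adj_iff hm, h]
  rw [card_filter_sigma_fst size (fun i => i = a ∨ i = b), ← Finset.sum_pair hab]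
  congr 1
  ext i
  simp

theorem degree_graphP {k m : ℕ} (hm : 3 ≤ m) (v : Σ i : Fin m, Fin (partSize k m i)) :
    ∃ a b : Fin m, (graphP k m).degree v = partSize k m a + partSize k m b ∧
      ((a : ℕ) = if (v.1 : ℕ) + 1 = m then 0 else (v.1 : ℕ) + 1) ∧
      ((b : ℕ) = if (v.1 : ℕ) = 0 then m - 1 else (v.1 : ℕ) - 1) := by
  have hv := v.1.isLt
  refine ⟨⟨if (v.1 : ℕ) + 1 = m then 0 else (v.1 : ℕ) + 1, by split_ifs <;> omega⟩,
    ⟨if (v.1 : ℕ) = 0 then m - 1 else (v.1 : ℕ) - 1, by split_ifs <;> omega⟩,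
    degree_braceletGraph hm _ v ?_ ?_, rfl, rfl⟩
  · rw [Ne, Fin.ext_iff]
    dsimp only
    split_ifs <;> omega
  · intro i
    have hi := i.isLt
    rw [cyclicAdj_iff, Fin.ext_iff, Fin.ext_iff]
    dsimp only
    split_ifs <;> omega

theorem minDegree_graphP {k m : ℕ} (hk : 2 ≤ k) (hm : 5 ≤ m) :
    (graphP k m).minDegree = 2 * k - 1 := by
  -- A vertex of part `1` sees parts `0` and `2`, of sizes `k - 1` and `k`.
  let v : Σ i : Fin m, Fin (partSize k m i) :=
    ⟨⟨1, by omega⟩, ⟨0, by simp only [partSize]; split_ifs <;> omega⟩⟩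
  have : Nonempty (Σ i : Fin m, Fin (partSize k m i)) := ⟨v⟩
  refine le_antisymm ?_ ((graphP k m).le_minDegree_of_forall_le_degree _ fun u => ?_)
  · obtain ⟨a, b, hdeg, ha, hb⟩ := degree_graphP (by omega) v
    refine ((graphP k m).minDegree_le_degree v).trans ?_
    have ha2 : (a : ℕ) = 2 := by rw [ha, if_neg (by simp only [v]; omega)]
    have hb0 : (b : ℕ) = 0 := by rw [hb, if_neg (by simp only [v]; omega)]; rfl
    rw [hdeg]
    simp only [partSize, ha2, hb0]
    split_ifs <;> omega
  · obtain ⟨a, b, hdeg, ha, hb⟩ := degree_graphP (by omega) u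
    have hu := u.1.isLt
    rw [hdeg]
    unfold partSize
    split_ifs at ha hb <;> split_ifs <;> omega

theorem maxDegree_graphP {k m : ℕ} (hm : 6 ≤ m) :
    (graphP k m).maxDegree = 2 * k + 2 := by
  refine le_antisymm ((graphP k m).maxDegree_le_of_forall_degree_le _ fun u => ?_) ?_
  · obtain ⟨a, b, hdeg, -, -⟩ := degree_graphP (by omega) u
    rw [hdeg]
    unfold partSize
    split_ifs <;> omega
  -- Part `4` lies between parts `3` and `5`, both of size `k + 1`; part `5` exists because `6 ≤ m`.
  · let v : Σ i : Fin m, Fin (partSize k m i) :=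
      ⟨⟨4, by omega⟩, ⟨0, by simp only [partSize]; split_ifs <;> omega⟩⟩
    obtain ⟨a, b, hdeg, ha, hb⟩ := degree_graphP (by omega) v
    refine le_trans ?_ ((graphP k m).degree_le_maxDegree v)
    have ha5 : (a : ℕ) = 5 := by rw [ha, if_neg (by simp only [v]; omega)]
    have hb3 : (b : ℕ) = 3 := by rw [hb, if_neg (by simp only [v]; omega)]; rfl
    rw [hdeg]
    simp only [partSize, ha5, hb3]
    split_ifs <;> omega

theorem isBraceletPartition_graphP {k m : ℕ} (hk : 2 ≤ k) (hm : 3 ≤ m) :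
    IsBraceletPartition (graphP k m) Sigma.fst := by
  refine ⟨hm, fun i => ⟨⟨i, ⟨0, ?_⟩⟩, rfl⟩, braceletGraph_adj_iff hm _⟩
  unfold partSize
  split_ifs <;> omega

theorem card_filter_natCast_fst {k m : ℕ} [NeZero m] (i : ZMod m) :
    (Finset.univ.filter fun v : Σ j : Fin m, Fin (partSize k m j) =>
      (((v.1 : ℕ) : ZMod m)) = i).card = ringSize k m i := by
  rw [card_filter_sigma_fst (partSize k m) fun j : Fin m => ((j : ℕ) : ZMod m) = i]
  have : (Finset.univ.filter fun j : Fin m => ((j : ℕ) : ZMod m) = i) =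
      {⟨i.val, ZMod.val_lt i⟩} := by
    ext j
    rw [Finset.mem_filter, Finset.mem_singleton, natCast_eq_iff_val_eq j.isLt, Fin.ext_iff]
    simp [eq_comm]
  rw [this, Finset.sum_singleton]
  rfl

theorem isKOrdered_graphP {k m : ℕ} (hk : 2 ≤ k) (hm : 5 ≤ m) :
    IsKOrdered (graphP k m) (2 * k) := by
  have : NeZero m := ⟨by omega⟩
  refine isKOrdered_of_routable (r := RingAdj m)
    (fun v : Σ j : Fin m, Fin (partSize k m j) => ((v.1 : ℕ) : ZMod m)) (fun u v h => ?_)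
    (by omega) ?_
  · rw [braceletGraph_adj_iff (by omega), cyclicAdj_iff_ringAdj]
    exact h
  · simp only [card_filter_natCast_fst]
    exact routable_of_count_le hm (by omega)

/-- Increasing `m` appends one nonempty part and leaves the earlier sizes unchanged. -/
theorem strictMono_card_graphP {k : ℕ} (hk : 2 ≤ k) :
    StrictMono fun m => Fintype.card (Σ i : Fin m, Fin (partSize k m i)) := by
  refine strictMono_nat_of_lt_succ fun m => ?_
  simp only [Fintype.card_sigma, Fintype.card_fin]
  rw [Fin.sum_univ_castSucc (n := m)]
  refine Nat.lt_add_of_pos_right ?_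
  unfold partSize
  split_ifs <;> omega

theorem theorem3p7 (k : ℕ) (hk : 2 ≤ k) :
    (∀ m : ℕ, 5 ≤ m →
      IsBraceletPartition (graphP k m) Sigma.fst ∧
      IsKOrdered (graphP k m) (2 * k) ∧
      (graphP k m).minDegree = 2 * k - 1) ∧
    (∀ m : ℕ, 6 ≤ m → (graphP k m).maxDegree = 2 * k + 2) ∧
    (∀ m m' : ℕ, 5 ≤ m → 5 ≤ m' → Nonempty (graphP k m ≃g graphP k m') → m = m') :=
  ⟨fun _ hm => ⟨isBraceletPartition_graphP hk (by omega), isKOrdered_graphP hk hm,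
    minDegree_graphP hk hm⟩, fun _ hm => maxDegree_graphP hm,
    fun _ _ _ _ ⟨e⟩ => (strictMono_card_graphP hk).injective (Fintype.card_congr e.toEquiv)⟩
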